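/- Let $G=(V,E)$ be a finite simple graph of order $n=|V|$ that is not complete. For a finite simple graph $H$, let $P(H,x)$ denote its chromatic polynomial, i.e. the unique real polynomial in $x$ such that, for every positive integer $k$, $P(H,k)$ is the number of proper colorings $V(H)\to\{1,\dots,k\}$. For $u\in V$ let $G-u$ denote the subgraph of $G$ induced by $V\setminus\{u\}$. Then for every real number $x<0$, $$(-1)^{n}(x-n+1)\sum_{u\in V}P(G-u,x)+(-1)^{n+1}\,n\,P(G,x)>0.$$ -/

import Mathlib

namespace SimpleGraph

/-- There is exactly one real polynomial whose value at each positive integer `k` is the number of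
proper `k`-colorings of the finite graph `G`. -/
theorem existsUnique_chromaticPolynomial {V : Type*} [Finite V] (G : SimpleGraph V) :
    ∃! p : Polynomial ℝ, ∀ k : ℕ, 0 < k →
      p.eval (k : ℝ) = (Nat.card (G.Coloring (Fin k)) : ℝ) := by
  classical
  -- Existence: sort the colorings by their kernels, the partitions of `V` into independent sets.
  have hex : ∃ p : Polynomial ℝ, ∀ k : ℕ, 0 < k →
      p.eval (k : ℝ) = (Nat.card (G.Coloring (Fin k)) : ℝ) := by
    have : Finite (Setoid V) :=
      Finite.of_injective (fun r : Setoid V => fun a b => r a b)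
        (fun r s h => Setoid.ext fun a b => by
          have := congrFun (congrFun h a) b
          exact Iff.of_eq this)
    let R := {r : Setoid V // ∀ a b, G.Adj a b → ¬ r a b}
    have : Fintype R := Fintype.ofFinite R
    refine ⟨∑ r : R, descPochhammer ℝ (Nat.card (Quotient r.1)), fun k _ => ?_⟩
    let e : G.Coloring (Fin k) ≃ Σ r : R, (Quotient r.1 ↪ Fin k) :=
      Equiv.ofBijective
        (fun C => ⟨⟨Setoid.ker C, fun a b hab h => C.valid hab h⟩,
          ⟨Quotient.lift C fun _ _ h => h, by
            rintro ⟨a⟩ ⟨b⟩ h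
            exact Quotient.sound h⟩⟩)
        (by
          constructor
          · intro C D h
            have key : ∀ s t : (Σ r : R, (Quotient r.1 ↪ Fin k)), s = t →
                ∀ v, s.2 (Quotient.mk _ v) = t.2 (Quotient.mk _ v) := by
              rintro s t rfl v
              rfl
            exact RelHom.ext fun v => key _ _ h v
          · rintro ⟨⟨r, hr⟩, f⟩
            have hker : Setoid.ker (fun v => f (Quotient.mk r v)) = r := by
              ext a b
              exact ⟨fun h => Quotient.exact (f.injective h), fun h => congrArg f (Quotient.sound h)⟩
            refine ⟨Coloring.mk (fun v => f (Quotient.mk r v)) (fun {a b} hab h =>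
              hr a b hab (Quotient.exact (f.injective h))), ?_⟩
            have key : ∀ (s : Setoid V) (hs : ∀ a b, G.Adj a b → ¬ s a b)
                (g : Quotient s ↪ Fin k), s = r →
                (∀ v, g (Quotient.mk s v) = f (Quotient.mk r v)) →
                (⟨⟨s, hs⟩, g⟩ : Σ r : R, (Quotient r.1 ↪ Fin k)) = ⟨⟨r, hr⟩, f⟩ := by
              rintro s hs g rfl hg
              have : g = f := by
                ext ⟨v⟩
                exact congrArg Fin.val (hg v)
              rw [this]
            exact key _ _ _ hker fun v => rfl)
    rw [Nat.card_congr e, Nat.card_sigma, Polynomial.eval_finsetSum, Nat.cast_sum]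
    refine Finset.sum_congr rfl fun r _ => ?_
    haveI : Fintype (Quotient r.1) := Fintype.ofFinite _
    rw [descPochhammer_eval_eq_descFactorial, Nat.card_eq_fintype_card, Nat.card_eq_fintype_card,
      Fintype.card_embedding_eq, Fintype.card_fin]
  obtain ⟨p, hp⟩ := hex
  refine ⟨p, hp, fun q hq => ?_⟩
  refine Polynomial.eq_of_infinite_eval_eq q p ?_
  refine Set.Infinite.mono (s := Set.range fun k : ℕ => ((k + 1 : ℕ) : ℝ)) ?_
    (Set.infinite_range_of_injective fun a b h => ?_)
  · rintro _ ⟨k, rfl⟩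
    exact (hq _ k.succ_pos).trans (hp _ k.succ_pos).symm
  · have : a + 1 = b + 1 := Nat.cast_injective h
    omega

/-- The chromatic polynomial of a finite graph `G`: the polynomial whose value at each positive
integer `k` is the number of proper `k`-colorings of `G`. -/
noncomputable def chromaticPolynomial {V : Type*} [Finite V] (G : SimpleGraph V) :
    Polynomial ℝ :=
  Classical.choose (existsUnique_chromaticPolynomial G).exists

/-- The defining property of the chromatic polynomial. -/
theorem chromaticPolynomial_eval_natCast {V : Type*} [Finite V] (G : SimpleGraph V)
    (k : ℕ) (hk : 0 < k) :
    G.chromaticPolynomial.eval (k : ℝ) = (Nat.card (G.Coloring (Fin k)) : ℝ) :=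
  Classical.choose_spec (existsUnique_chromaticPolynomial G).exists k hk

end SimpleGraph

/-!
Write `q(G, T) = (-1) ^ #T * P(G[T], -y)` with `0 < y`. Deletion–contraction then has no sign,
`q(G, T) = q(G - sw, T) + q(G / sw, T - w)`, so `q` is positive. Fix a root `s ∈ T` and let
`E(G, T) = y * q(T - s) + ∑ u ≠ s, q(T - u) - q(T)`. Deleting an edge `sw` gives
`E(G, T) = E(G - sw, T) + E(G / sw, T - w) - y * q(T - s - w)`, while `w` becomes a non-neighbour
of `s`. Hence `E(G, T)` is at least `y` times the sum of `q(T - s - u)` over the non-neighbours `u`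
of `s`: the lost term is exactly the one that `w` contributes to this bound for `G - sw`. Summing
`E` over all roots gives `(y + #T - 1) * ∑ u, q(T - u) - #T * q(T)`, which is positive as soon as
one root has a non-neighbour.
-/

namespace ChromaticPolynomial

open Finset Polynomial SimpleGraph

variable {V : Type*}

theorem eq_chromaticPolynomial [Finite V] {G : SimpleGraph V} {p : ℝ[X]}
    (h : ∀ k : ℕ, 0 < k → p.eval (k : ℝ) = Nat.card (G.Coloring (Fin k))) :
    p = G.chromaticPolynomial :=
  (existsUnique_chromaticPolynomial G).unique h (chromaticPolynomial_eval_natCast G)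

theorem chromaticPolynomial_congr {W : Type*} [Finite V] [Finite W] {G : SimpleGraph V}
    {H : SimpleGraph W} (e : G ≃g H) : G.chromaticPolynomial = H.chromaticPolynomial :=
  eq_chromaticPolynomial fun k hk => by
    rw [chromaticPolynomial_eval_natCast G k hk,
      Nat.card_congr (RelIso.relHomCongr e (RelIso.refl _))]

theorem chromaticPolynomial_of_isEmpty [IsEmpty V] (G : SimpleGraph V) :
    G.chromaticPolynomial = 1 := by
  refine (eq_chromaticPolynomial fun k _ => ?_).symm
  have : Unique (G.Coloring (Fin k)) := ⟨⟨.ofIsEmpty⟩, fun C => RelHom.ext isEmptyElim⟩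
  simp

section DeletionContraction

variable {G : SimpleGraph V} {T : Finset V} {s w : V}

theorem card_coloring_induce_eq_card_deleteEdges_ne (α : Type*) (hs : s ∈ T) (hw : w ∈ T)
    (h : G.Adj s w) :
    Nat.card ((G.induce (T : Set V)).Coloring α) =
      Nat.card {C : ((G.deleteEdges {s(s, w)}).induce (T : Set V)).Coloring α //
        C ⟨s, hs⟩ ≠ C ⟨w, hw⟩} := by
  refine Nat.card_congr
    { toFun C := ⟨C.comap (.ofLE fun a b hab => (deleteEdges_adj.1 hab).1), C.valid h⟩
      invFun C := .mk C.1 ?_ }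
  intro a b hab
  by_cases he : s(a.1, b.1) = s(s, w)
  · obtain ⟨ha, hb⟩ | ⟨ha, hb⟩ := Sym2.eq_iff.1 he
    · obtain rfl : a = ⟨s, hs⟩ := Subtype.ext ha
      obtain rfl : b = ⟨w, hw⟩ := Subtype.ext hb
      exact C.2
    · obtain rfl : a = ⟨w, hw⟩ := Subtype.ext ha
      obtain rfl : b = ⟨s, hs⟩ := Subtype.ext hb
      exact C.2.symm
  · exact C.1.valid (deleteEdges_adj.2 ⟨hab, he⟩)

variable [DecidableEq V]

theorem card_coloring_induce_of_isolated (α : Type*) (hs : s ∈ T) (h : ∀ a ∈ T, ¬G.Adj s a) :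
    Nat.card ((G.induce (T : Set V)).Coloring α) =
      Nat.card α * Nat.card ((G.induce (T.erase s : Finset V)).Coloring α) := by
  rw [← Nat.card_prod]
  refine Nat.card_congr
    { toFun C := (C ⟨s, hs⟩, C.comap (G.induceHomOfLE (erase_subset s T)).toHom)
      invFun C := .mk (fun v => if hv : v.1 = s then C.1 else C.2 ⟨v, mem_erase.2 ⟨hv, v.2⟩⟩) ?_
      left_inv C := ?_
      right_inv C := ?_ }
  · intro a b hab
    have hab' : G.Adj a b := hab
    have ha : a.1 ≠ s := fun e => h b b.2 (e ▸ hab')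
    have hb : b.1 ≠ s := fun e => h a a.2 (e ▸ hab'.symm)
    simp only [ha, hb, dite_false]
    exact C.2.valid hab
  · refine RelHom.ext fun v => ?_
    by_cases hv : v.1 = s
    · obtain rfl : v = ⟨s, hs⟩ := Subtype.ext hv
      exact dif_pos rfl
    · exact dif_neg hv
  · exact Prod.ext (dif_pos rfl) (RelHom.ext fun v => dif_neg (ne_of_mem_erase v.2))

/-- The contraction of `w` into `s`. The vertex set is kept, so `w` survives as an isolated vertex:
the contraction proper is the subgraph induced on a set of vertices avoiding `w`. -/
def contract (G : SimpleGraph V) (s w : V) : SimpleGraph V :=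
  G.map (Function.update id w s)

theorem contract_adj_iff (hsw : s ≠ w) {a b : V} :
    (contract G s w).Adj a b ↔ ∃ a' b', (G.deleteEdges {s(s, w)}).Adj a' b' ∧
      Function.update id w s a' = a ∧ Function.update id w s b' = b := by
  simp only [deleteEdges_adj, Set.mem_singleton_iff, Sym2.eq_iff]
  constructor
  · rintro ⟨hne, a', b', h, rfl, rfl⟩
    refine ⟨a', b', ⟨h, ?_⟩, rfl, rfl⟩
    rintro (⟨rfl, rfl⟩ | ⟨rfl, rfl⟩) <;> simp [hsw] at hne
  · rintro ⟨a', b', ⟨h, he⟩, rfl, rfl⟩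
    refine ⟨?_, a', b', h, rfl, rfl⟩
    have := h.ne
    grind [Function.update_apply]

theorem contract_adj_of_ne {a b : V} (has : a ≠ s) (hbs : b ≠ s) (haw : a ≠ w) (hbw : b ≠ w) :
    (contract G s w).Adj a b ↔ G.Adj a b := by
  constructor
  · rintro ⟨-, a', b', h, rfl, rfl⟩
    grind [Function.update_apply]
  · exact fun h => ⟨h.ne, a, b, h, by simp [haw], by simp [hbw]⟩

theorem card_coloring_contract_eq_card_deleteEdges_eq (α : Type*) (hs : s ∈ T) (hw : w ∈ T)
    (hsw : s ≠ w) :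
    Nat.card (((contract G s w).induce (T.erase w : Finset V)).Coloring α) =
      Nat.card {C : ((G.deleteEdges {s(s, w)}).induce (T : Set V)).Coloring α //
        C ⟨s, hs⟩ = C ⟨w, hw⟩} := by
  have merge_mem (v : T) : Function.update id w s v.1 ∈ T.erase w := by
    grind [Function.update_apply]
  let merge (v : T) : (T.erase w : Finset V) := ⟨Function.update id w s v.1, merge_mem v⟩
  have merge_s : merge ⟨s, hs⟩ = merge ⟨w, hw⟩ := by simp [merge, hsw]
  have apply_merge {C : ((G.deleteEdges {s(s, w)}).induce (T : Set V)).Coloring α}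
      (hC : C ⟨s, hs⟩ = C ⟨w, hw⟩) (v : T) : C ⟨merge v, mem_of_mem_erase (merge v).2⟩ = C v := by
    by_cases hv : v.1 = w
    · obtain rfl : v = ⟨w, hw⟩ := Subtype.ext hv
      simpa [merge] using hC
    · simp [merge, hv]
  refine Nat.card_congr
    { toFun C := ⟨.mk (C ∘ merge) ?_, congrArg C merge_s⟩
      invFun C := .mk (fun v => C.1 ⟨v, mem_of_mem_erase v.2⟩) ?_
      left_inv C := RelHom.ext fun v => congrArg C (Subtype.ext ?_)
      right_inv C := Subtype.ext (RelHom.ext fun v => apply_merge C.2 v) }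
  · exact fun {a b} hab => C.valid ((contract_adj_iff hsw).2 ⟨a, b, hab, rfl, rfl⟩)
  · intro a b hab
    obtain ⟨a', b', hab', ha, hb⟩ := (contract_adj_iff hsw).1 hab
    have exists_merge_eq (v : (T.erase w : Finset V)) {v' : V}
        (hv : Function.update id w s v' = v) : ∃ u : T, u.1 = v' ∧ merge u = v :=
      ⟨⟨v', by grind [Function.update_apply]⟩, rfl, Subtype.ext hv⟩
    obtain ⟨a', rfl, rfl⟩ := exists_merge_eq a ha
    obtain ⟨b', rfl, rfl⟩ := exists_merge_eq b hb
    rw [apply_merge C.2, apply_merge C.2]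
    exact C.1.valid hab'
  · simp [merge, ne_of_mem_erase v.2]

theorem chromaticPolynomial_induce_of_isolated (hs : s ∈ T) (h : ∀ a ∈ T, ¬G.Adj s a) :
    (G.induce (T : Set V)).chromaticPolynomial =
      X * (G.induce (T.erase s : Finset V)).chromaticPolynomial :=
  (eq_chromaticPolynomial fun k hk => by
    rw [eval_mul, eval_X, chromaticPolynomial_eval_natCast _ k hk,
      card_coloring_induce_of_isolated (Fin k) hs h, Nat.card_fin, Nat.cast_mul]).symm

theorem chromaticPolynomial_induce_deleteEdges (hs : s ∈ T) (hw : w ∈ T) (h : G.Adj s w) :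
    ((G.deleteEdges {s(s, w)}).induce (T : Set V)).chromaticPolynomial =
      (G.induce (T : Set V)).chromaticPolynomial +
        ((contract G s w).induce (T.erase w : Finset V)).chromaticPolynomial :=
  (eq_chromaticPolynomial fun k hk => by
    rw [eval_add, chromaticPolynomial_eval_natCast _ k hk, chromaticPolynomial_eval_natCast _ k hk,
      card_coloring_induce_eq_card_deleteEdges_ne (Fin k) hs hw h,
      card_coloring_contract_eq_card_deleteEdges_eq (Fin k) hs hw h.ne, ← Nat.cast_add,
      ← Nat.card_sum, Nat.card_congr ((Equiv.sumComm _ _).trans (Equiv.sumCompl _))]).symm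

end DeletionContraction

section SignedChromatic

/-- The chromatic polynomial of the subgraph of `G` induced on `T`, evaluated at `-y` and
normalized by the sign `(-1) ^ #T`, which makes it positive for `0 < y`. -/
noncomputable def signedChromatic (G : SimpleGraph V) (T : Finset V) (y : ℝ) : ℝ :=
  (-1) ^ #T * (G.induce (T : Set V)).chromaticPolynomial.eval (-y)

variable {G H : SimpleGraph V} {T : Finset V} {s w : V} {y : ℝ}

theorem signedChromatic_congr (h : ∀ a ∈ T, ∀ b ∈ T, G.Adj a b ↔ H.Adj a b) :
    signedChromatic G T y = signedChromatic H T y := by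
  have : G.induce (T : Set V) = H.induce (T : Set V) :=
    SimpleGraph.ext (funext₂ fun a b => propext (h a a.2 b b.2))
  rw [signedChromatic, this, signedChromatic]

@[simp]
theorem signedChromatic_empty (G : SimpleGraph V) (y : ℝ) : signedChromatic G ∅ y = 1 := by
  have : IsEmpty ((∅ : Finset V) : Set V) := by simp
  simp [signedChromatic, chromaticPolynomial_of_isEmpty]

theorem signedChromatic_univ [Fintype V] (G : SimpleGraph V) (y : ℝ) :
    signedChromatic G univ y = (-1) ^ Fintype.card V * G.chromaticPolynomial.eval (-y) := by
  have e : G.induce ((univ : Finset V) : Set V) ≃g G := coe_univ (α := V) ▸ G.induceUnivIso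
  rw [signedChromatic, chromaticPolynomial_congr e, card_univ]

theorem signedChromatic_deleteEdges_of_notMem (h : s ∉ T ∨ w ∉ T) :
    signedChromatic (G.deleteEdges {s(s, w)}) T y = signedChromatic G T y :=
  signedChromatic_congr fun a ha b hb => by
    simp only [deleteEdges_adj, Set.mem_singleton_iff, Sym2.eq_iff]
    grind

variable [DecidableEq V]

theorem signedChromatic_univ_erase [Fintype V] (G : SimpleGraph V) (u : V) (y : ℝ) :
    signedChromatic G (univ.erase u) y = (-1) ^ (Fintype.card V + 1) *
      (G.induce ({u}ᶜ : Set V)).chromaticPolynomial.eval (-y) := by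
  have e : G.induce ((univ.erase u : Finset V) : Set V) ≃g G.induce ({u}ᶜ : Set V) :=
    ⟨Equiv.setCongr (by ext; simp), Iff.rfl⟩
  rw [signedChromatic, chromaticPolynomial_congr e, ← card_univ,
    ← card_erase_add_one (mem_univ u), pow_add, pow_add]
  ring

theorem signedChromatic_of_isolated (hs : s ∈ T) (h : ∀ a ∈ T, ¬G.Adj s a) :
    signedChromatic G T y = y * signedChromatic G (T.erase s) y := by
  rw [signedChromatic, signedChromatic, chromaticPolynomial_induce_of_isolated hs h,
    ← card_erase_add_one hs, pow_succ, eval_mul, eval_X]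
  ring

theorem signedChromatic_eq_deleteEdges_add_contract (hs : s ∈ T) (hw : w ∈ T) (h : G.Adj s w) :
    signedChromatic G T y = signedChromatic (G.deleteEdges {s(s, w)}) T y +
      signedChromatic (contract G s w) (T.erase w) y := by
  simp only [signedChromatic]
  rw [chromaticPolynomial_induce_deleteEdges hs hw h, ← card_erase_add_one hw, pow_succ, eval_add]
  ring

theorem signedChromatic_contract_of_notMem (hs : s ∉ T) (hw : w ∉ T) :
    signedChromatic (contract G s w) T y = signedChromatic G T y :=
  signedChromatic_congr fun _ ha _ hb => contract_adj_of_ne (ne_of_mem_of_not_mem ha hs)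
    (ne_of_mem_of_not_mem hb hs) (ne_of_mem_of_not_mem ha hw) (ne_of_mem_of_not_mem hb hw)

end SignedChromatic

section Positivity

theorem induction_on_edges_at (T : Finset V) (s : V) {P : SimpleGraph V → Prop}
    (isolated : ∀ G, (∀ a ∈ T, ¬G.Adj s a) → P G)
    (step : ∀ G, ∀ w ∈ T, G.Adj s w → P (G.deleteEdges {s(s, w)}) → P G) (G : SimpleGraph V) :
    P G := by
  classical
  induction h : {a ∈ T | G.Adj s a} using Finset.strongInduction generalizing G with
  | H N ih =>
    subst h
    by_cases hG : ∀ a ∈ T, ¬G.Adj s a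
    · exact isolated G hG
    · push Not at hG
      obtain ⟨w, hw, hsw⟩ := hG
      refine step G w hw hsw (ih _ (Finset.ssubset_iff.2 ⟨w, ?_, ?_⟩) _ rfl)
      · simp
      · refine insert_subset (by simp [hw, hsw]) fun a ha => ?_
        simp_all

theorem signedChromatic_pos {y : ℝ} (hy : 0 < y) (G : SimpleGraph V) (T : Finset V) :
    0 < signedChromatic G T y := by
  classical
  induction T using Finset.strongInduction generalizing G with
  | H T ih =>
    obtain rfl | ⟨s, hs⟩ := T.eq_empty_or_nonempty
    · simp
    · induction G using induction_on_edges_at T s with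
      | isolated G h =>
        rw [signedChromatic_of_isolated hs h]
        exact mul_pos hy (ih _ (erase_ssubset hs) G)
      | step G w hw hsw h =>
        rw [signedChromatic_eq_deleteEdges_add_contract hs hw hsw]
        exact add_pos h (ih _ (erase_ssubset hw) _)

end Positivity

section RootedExcess

variable [DecidableEq V] {G : SimpleGraph V} {T : Finset V} {s w : V} {y : ℝ}

/-- The excess, over `signedChromatic G T y`, of the sum of the values at the vertex-deleted
subgraphs, where the summand of the root `s` has weight `y`. Deletion–contraction at the edges
at `s` bounds it from below. -/
noncomputable def rootedExcess (G : SimpleGraph V) (T : Finset V) (s : V) (y : ℝ) : ℝ :=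
  y * signedChromatic G (T.erase s) y + ∑ u ∈ T.erase s, signedChromatic G (T.erase u) y -
    signedChromatic G T y

theorem rootedExcess_of_isolated (hs : s ∈ T) (h : ∀ a ∈ T, ¬G.Adj s a) :
    rootedExcess G T s y = y * ∑ u ∈ T.erase s, signedChromatic G ((T.erase s).erase u) y := by
  rw [rootedExcess, signedChromatic_of_isolated hs h, mul_sum, add_sub_cancel_left]
  refine sum_congr rfl fun u hu => ?_
  rw [signedChromatic_of_isolated (mem_erase.2 ⟨(ne_of_mem_erase hu).symm, hs⟩)
    fun a ha => h a (mem_of_mem_erase ha), erase_right_comm]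

theorem rootedExcess_eq_deleteEdges_add_contract (hs : s ∈ T) (hw : w ∈ T) (h : G.Adj s w) :
    rootedExcess G T s y = rootedExcess (G.deleteEdges {s(s, w)}) T s y +
      rootedExcess (contract G s w) (T.erase w) s y -
        y * signedChromatic G ((T.erase s).erase w) y := by
  have hwT : w ∈ T.erase s := mem_erase.2 ⟨h.ne', hw⟩
  have hsum : ∑ u ∈ (T.erase s).erase w, signedChromatic G (T.erase u) y =
      ∑ u ∈ (T.erase s).erase w, signedChromatic (G.deleteEdges {s(s, w)}) (T.erase u) y +
        ∑ u ∈ (T.erase s).erase w, signedChromatic (contract G s w) ((T.erase w).erase u) y := by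
    rw [← sum_add_distrib]
    refine sum_congr rfl fun u hu => ?_
    rw [erase_right_comm (a := w)]
    exact signedChromatic_eq_deleteEdges_add_contract (by grind) (by grind) h
  simp only [rootedExcess]
  rw [signedChromatic_eq_deleteEdges_add_contract hs hw h, ← add_sum_erase _ _ hwT,
    ← add_sum_erase (T.erase s) _ hwT, hsum, erase_right_comm (a := w) (b := s),
    signedChromatic_deleteEdges_of_notMem (.inl (notMem_erase s T)),
    signedChromatic_deleteEdges_of_notMem (.inr (notMem_erase w T)),
    signedChromatic_contract_of_notMem (T := (T.erase s).erase w) (by simp) (by simp)]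
  ring

theorem mul_sum_signedChromatic_le_rootedExcess (hy : 0 < y) (hs : s ∈ T) {N : Finset V}
    (hN : N ⊆ T.erase s) (hsN : ∀ u ∈ N, ¬G.Adj s u) :
    y * ∑ u ∈ N, signedChromatic G ((T.erase s).erase u) y ≤ rootedExcess G T s y := by
  induction T using Finset.strongInduction generalizing G N with
  | H T ih =>
    induction G using induction_on_edges_at T s generalizing N with
    | isolated G h =>
      rw [rootedExcess_of_isolated hs h]
      gcongr
      exact fun _ _ _ => (signedChromatic_pos hy G _).le
    | step G w hw hsw h =>
      have hwN : w ∉ N := fun hwN => hsN w hwN hsw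
      have deletion_bound := h (N := insert w N)
        (insert_subset (mem_erase.2 ⟨hsw.ne', hw⟩) hN) fun u hu => by
          simp only [deleteEdges_adj, Set.mem_singleton_iff]
          grind
      have contraction_nonneg : 0 ≤ rootedExcess (contract G s w) (T.erase w) s y := by
        simpa using ih (T.erase w) (erase_ssubset hw) (G := contract G s w)
          (mem_erase.2 ⟨hsw.ne, hs⟩) (N := ∅)
      rw [sum_insert hwN] at deletion_bound
      simp only [signedChromatic_deleteEdges_of_notMem (s := s) (w := w) (G := G)
        (T := (T.erase s).erase _) (.inl (by simp))] at deletion_bound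
      rw [rootedExcess_eq_deleteEdges_add_contract hs hw hsw]
      linarith

theorem sum_rootedExcess (G : SimpleGraph V) (T : Finset V) (y : ℝ) :
    ∑ s ∈ T, rootedExcess G T s y =
      (y + #T - 1) * ∑ u ∈ T, signedChromatic G (T.erase u) y - #T * signedChromatic G T y := by
  have h : ∀ s ∈ T, rootedExcess G T s y = (y - 1) * signedChromatic G (T.erase s) y +
      (∑ u ∈ T, signedChromatic G (T.erase u) y - signedChromatic G T y) := fun s hs => by
    rw [rootedExcess, ← add_sum_erase _ _ hs]
    ring
  rw [sum_congr rfl h, sum_add_distrib, ← mul_sum, sum_const, nsmul_eq_mul]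
  ring

theorem card_mul_signedChromatic_lt (hy : 0 < y) {u v : V} (hu : u ∈ T) (hv : v ∈ T)
    (huv : u ≠ v) (hadj : ¬G.Adj u v) :
    #T * signedChromatic G T y < (y + #T - 1) * ∑ u ∈ T, signedChromatic G (T.erase u) y := by
  have nonneg : ∀ s ∈ T, 0 ≤ rootedExcess G T s y := fun s hs => by
    simpa using mul_sum_signedChromatic_le_rootedExcess hy hs (N := ∅) (G := G)
  have pos : 0 < rootedExcess G T u y := by
    refine (mul_pos hy (signedChromatic_pos hy G ((T.erase u).erase v))).trans_le ?_
    simpa [hadj, hv, huv.symm] using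
      mul_sum_signedChromatic_le_rootedExcess hy hu (N := {v}) (G := G)
  rw [← sub_pos, ← sum_rootedExcess]
  exact sum_pos' nonneg ⟨u, hu, pos⟩

end RootedExcess

end ChromaticPolynomial

theorem mainTheorem3 {V : Type*} [Fintype V] (G : SimpleGraph V) (n : ℕ)
    (hn : Fintype.card V = n) (hG : G ≠ ⊤) (x : ℝ) (hx : x < 0) :
    0 < (-1 : ℝ) ^ n * (x - (n : ℝ) + 1) *
          ∑ u : V, (G.induce ({u}ᶜ : Set V)).chromaticPolynomial.eval x
        + (-1 : ℝ) ^ (n + 1) * (n : ℝ) * G.chromaticPolynomial.eval x := by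
  classical
  obtain ⟨u, v, huv, hadj⟩ := SimpleGraph.ne_top_iff_exists_not_adj.1 hG
  have h := ChromaticPolynomial.card_mul_signedChromatic_lt (neg_pos.2 hx) (Finset.mem_univ u)
    (Finset.mem_univ v) huv hadj
  simp only [ChromaticPolynomial.signedChromatic_univ_erase,
    ChromaticPolynomial.signedChromatic_univ, ← Finset.mul_sum, Finset.card_univ, hn,
    neg_neg] at h
  refine (sub_pos.2 h).trans_eq ?_
  ring
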